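/- Let $n\ge 2$ and let $k_1,\dots,k_n$ be positive integers, where the case $n=2$, $k_1=k_2=1$ is excluded. Let $S(k_1,\dots,k_n)$ be the graph obtained from the star $K_{1,n}$ with root $v_1$ by inserting $k_j-1$ new vertices into its $j$-th edge, for each $j$, so that this edge becomes a path with $k_j+1$ vertices (root included). Let $\Gamma$ be the infinite graph obtained from the disjoint union of $S(k_1,\dots,k_n)$ and the one-sided infinite path by joining the root $v_1$ to the end vertex of the path by a new edge. Let $A$ be the adjacency operator of $\Gamma$, that is, the bounded self-adjoint operator on the complex Hilbert space $\ell^2(\mathcal V(\Gamma))$ given by $(Af)(v)=\sum_{w\sim v}f(w)$. Then the equation $$\sum_{j=1}^n\frac{\sinh(k_jt)}{\sinh((k_j+1)t)}=e^t \qquad (*)$$ has exactly one solution $t_+$ in $(0,\infty)$, and the discrete spectrum $\sigma_d(\Gamma)$, i.e. the set of eigenvalues of $A$ of finite multiplicity that lie outside $[-2,2]$, coincides with the part of the spectrum outside $[-2,2]$ and equals $$\sigma_d(\Gamma)=\sigma(A)\setminus[-2,2]=\{2\cosh t_+,\,-2\cosh t_+\}.$$ Moreover, if $k_1=\dots=k_n=p$,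 then a number $t>0$ satisfies $(*)$ if and only if $x=e^{-t}$ satisfies $$(n-1)x^{2p+2}-nx^2+1=0.$$ -/

import Mathlib

open scoped ENNReal

noncomputable section

namespace TailedGraph

variable {V W : Type*}

/-- The vertex degrees are finite and uniformly bounded. -/
def UniformlyLocallyFinite (G : SimpleGraph V) : Prop :=
  ∃ d : ℕ, ∀ v, (G.neighborSet v).encard ≤ d

theorem UniformlyLocallyFinite.finite {G : SimpleGraph V} (h : UniformlyLocallyFinite G) (v : V) :
    (G.neighborSet v).Finite := by
  obtain ⟨d, hd⟩ := h
  exact Set.finite_of_encard_le_coe (hd v)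

/-- The finite set of neighbours of `v`. -/
def UniformlyLocallyFinite.nbrs {G : SimpleGraph V} (h : UniformlyLocallyFinite G) (v : V) :
    Finset V :=
  (h.finite v).toFinset

theorem UniformlyLocallyFinite.mem_nbrs {G : SimpleGraph V} (h : UniformlyLocallyFinite G)
    {v w : V} : w ∈ h.nbrs v ↔ G.Adj v w := by
  simp [UniformlyLocallyFinite.nbrs]

theorem UniformlyLocallyFinite.exists_card_le {G : SimpleGraph V}
    (h : UniformlyLocallyFinite G) : ∃ d : ℕ, ∀ v, (h.nbrs v).card ≤ d := by
  obtain ⟨d, hd⟩ := id h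
  refine ⟨d, fun v => ?_⟩
  have := hd v
  rw [(h.finite v).encard_eq_coe_toFinset_card] at this
  exact_mod_cast this

theorem sum_sq_le {G : SimpleGraph V} (h : UniformlyLocallyFinite G) {d : ℕ}
    (hd : ∀ v, (h.nbrs v).card ≤ d) (f : lp (fun _ : V => ℂ) 2) (s : Finset V) :
    ∑ v ∈ s, ‖∑ w ∈ h.nbrs v, f w‖ ^ (2 : ℝ≥0∞).toReal
      ≤ ((d : ℝ) * ‖f‖) ^ (2 : ℝ≥0∞).toReal := by
  classical
  have key : ∀ u : Finset V, ∑ w ∈ u, ‖f w‖ ^ 2 ≤ ‖f‖ ^ 2 := by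
    intro u
    have := lp.sum_rpow_le_norm_rpow (p := 2) (by norm_num) f u
    simpa using this
  have h1 : ∀ v ∈ s, ‖∑ w ∈ h.nbrs v, f w‖ ^ 2
      ≤ (d : ℝ) * ∑ w ∈ s.biUnion h.nbrs, if w ∈ h.nbrs v then ‖f w‖ ^ 2 else 0 := by
    intro v hv
    have e : (∑ w ∈ s.biUnion h.nbrs, if w ∈ h.nbrs v then ‖f w‖ ^ 2 else 0)
        = ∑ w ∈ h.nbrs v, ‖f w‖ ^ 2 := by
      rw [← Finset.sum_filter]
      congr 1
      ext w
      simp only [Finset.mem_filter, Finset.mem_biUnion]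
      exact ⟨fun hw => hw.2, fun hw => ⟨⟨v, hv, hw⟩, hw⟩⟩
    rw [e]
    calc ‖∑ w ∈ h.nbrs v, f w‖ ^ 2 ≤ (∑ w ∈ h.nbrs v, ‖f w‖) ^ 2 := by
          gcongr
          exact norm_sum_le _ _
      _ ≤ ((h.nbrs v).card : ℝ) * ∑ w ∈ h.nbrs v, ‖f w‖ ^ 2 := sq_sum_le_card_mul_sum_sq
      _ ≤ (d : ℝ) * ∑ w ∈ h.nbrs v, ‖f w‖ ^ 2 := by
          gcongr
          exact_mod_cast hd v
  have h2 : ∀ w, (∑ v ∈ s, if w ∈ h.nbrs v then ‖f w‖ ^ 2 else 0) ≤ (d : ℝ) * ‖f w‖ ^ 2 := by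
    intro w
    rw [← Finset.sum_filter, Finset.sum_const, nsmul_eq_mul]
    have hc : (s.filter fun v => w ∈ h.nbrs v).card ≤ d := by
      refine le_trans (Finset.card_le_card ?_) (hd w)
      intro v hv
      exact h.mem_nbrs.2 (h.mem_nbrs.1 (Finset.mem_filter.1 hv).2).symm
    gcongr
  have : ∑ v ∈ s, ‖∑ w ∈ h.nbrs v, f w‖ ^ 2 ≤ ((d : ℝ) * ‖f‖) ^ 2 := by
    calc ∑ v ∈ s, ‖∑ w ∈ h.nbrs v, f w‖ ^ 2
        ≤ ∑ v ∈ s, (d : ℝ) * ∑ w ∈ s.biUnion h.nbrs,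
            if w ∈ h.nbrs v then ‖f w‖ ^ 2 else 0 := Finset.sum_le_sum h1
      _ = (d : ℝ) * ∑ w ∈ s.biUnion h.nbrs, ∑ v ∈ s,
            if w ∈ h.nbrs v then ‖f w‖ ^ 2 else 0 := by
          rw [← Finset.mul_sum, Finset.sum_comm]
      _ ≤ (d : ℝ) * ∑ w ∈ s.biUnion h.nbrs, (d : ℝ) * ‖f w‖ ^ 2 := by
          gcongr with w hw
          exact h2 w
      _ = (d : ℝ) * ((d : ℝ) * ∑ w ∈ s.biUnion h.nbrs, ‖f w‖ ^ 2) := by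
          rw [← Finset.mul_sum]
      _ ≤ (d : ℝ) * ((d : ℝ) * ‖f‖ ^ 2) := by
          gcongr
          exact key _
      _ = ((d : ℝ) * ‖f‖) ^ 2 := by ring
  simpa using this

/-- The adjacency operator of a uniformly locally finite graph `G` as a linear map on `ℓ²(V)`:
`(A f)(v)` is the sum of `f w` over the neighbours `w` of `v`. -/
def adjacencyLinearMap (G : SimpleGraph V) (h : UniformlyLocallyFinite G) :
    lp (fun _ : V => ℂ) 2 →ₗ[ℂ] lp (fun _ : V => ℂ) 2 where
  toFun f := ⟨fun v => ∑ w ∈ h.nbrs v, f w, by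
    obtain ⟨d, hd⟩ := h.exists_card_le
    exact memℓp_gen' (sum_sq_le h hd f)⟩
  map_add' f g := by
    ext v
    exact Finset.sum_add_distrib
  map_smul' c f := by
    ext v
    simp [Finset.mul_sum]

/-- The adjacency operator of a uniformly locally finite graph, a bounded operator on `ℓ²(V)`. -/
def adjacencyOperator (G : SimpleGraph V) (h : UniformlyLocallyFinite G) :
    lp (fun _ : V => ℂ) 2 →L[ℂ] lp (fun _ : V => ℂ) 2 where
  toLinearMap := adjacencyLinearMap G h
  cont := by
    obtain ⟨d, hd⟩ := h.exists_card_le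
    refine AddMonoidHomClass.continuous_of_bound (adjacencyLinearMap G h) d fun f => ?_
    exact lp.norm_le_of_forall_sum_le (by norm_num) (by positivity) (sum_sq_le h hd f)

theorem adjacencyOperator_apply (G : SimpleGraph V) (h : UniformlyLocallyFinite G)
    (f : lp (fun _ : V => ℂ) 2) (v : V) :
    adjacencyOperator G h f v = ∑ w ∈ h.nbrs v, f w := rfl

/-- The coupling of two graphs by the bridge `{v, w}`: their disjoint union together with
the edge from `v` to `w`. -/
def coupling (G : SimpleGraph V) (H : SimpleGraph W) (v : V) (w : W) : SimpleGraph (V ⊕ W) :=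
  SimpleGraph.sum G H ⊔ SimpleGraph.edge (Sum.inl v) (Sum.inr w)

/-- The one-sided infinite path `0 - 1 - 2 - ⋯`. -/
def ray : SimpleGraph ℕ :=
  SimpleGraph.hasse ℕ

/-- The star with `n` edges whose `j`-th edge is subdivided so as to contain `k j + 1` vertices.
The root is `none`, and `some ⟨j, i⟩` is the vertex of the `j`-th edge at distance `i + 1` from
the root. -/
def multipleStar {n : ℕ} (k : Fin n → ℕ) : SimpleGraph (Option (Σ j : Fin n, Fin (k j))) :=
  SimpleGraph.fromRel fun a b =>
    (∃ (j : Fin n) (i : Fin (k j)), a = none ∧ b = some ⟨j, i⟩ ∧ i.val = 0) ∨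
    (∃ (j : Fin n) (i i' : Fin (k j)),
      a = some ⟨j, i⟩ ∧ b = some ⟨j, i'⟩ ∧ i'.val = i.val + 1)

/-- The multiple star with the infinite path attached to its root. -/
def multipleStarRay {n : ℕ} (k : Fin n → ℕ) :
    SimpleGraph (Option (Σ j : Fin n, Fin (k j)) ⊕ ℕ) :=
  coupling (multipleStar k) ray none 0

theorem uniformlyLocallyFinite_ray : UniformlyLocallyFinite ray := by
  refine ⟨2, fun v => ?_⟩
  have : ray.neighborSet v ⊆ {v - 1, v + 1} := by
    intro w hw
    simp only [ray, SimpleGraph.mem_neighborSet, SimpleGraph.hasse_adj,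
      Nat.covBy_iff_add_one_eq] at hw
    simp only [Set.mem_insert_iff, Set.mem_singleton_iff]
    omega
  refine (Set.encard_le_encard this).trans ((Set.encard_insert_le _ _).trans ?_)
  rw [Set.encard_singleton]
  norm_num

theorem uniformlyLocallyFinite_of_finite [Finite V] (G : SimpleGraph V) :
    UniformlyLocallyFinite G := by
  refine ⟨Nat.card V, fun v => ?_⟩
  refine (Set.encard_le_encard (Set.subset_univ _)).trans ?_
  rw [Set.encard_univ, ENat.card_eq_coe_natCard]

theorem uniformlyLocallyFinite_coupling {G : SimpleGraph V} {H : SimpleGraph W}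
    (hG : UniformlyLocallyFinite G) (hH : UniformlyLocallyFinite H) (v : V) (w : W) :
    UniformlyLocallyFinite (coupling G H v w) := by
  obtain ⟨d, hd⟩ := hG
  obtain ⟨e, he⟩ := hH
  refine ⟨d + e + 1, fun x => ?_⟩
  rcases x with a | b
  · have : (coupling G H v w).neighborSet (Sum.inl a)
        ⊆ Sum.inl '' G.neighborSet a ∪ {Sum.inr w} := by
      rintro (y | y) hy <;> simp_all [coupling, SimpleGraph.edge_adj]
    calc _ ≤ _ := Set.encard_le_encard this
      _ ≤ _ := Set.encard_union_le _ _
      _ ≤ (d : ℕ∞) + 1 := by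
        gcongr
        · exact (Set.encard_image_le _ _).trans (hd a)
        · simp
      _ ≤ _ := by norm_cast; omega
  · have : (coupling G H v w).neighborSet (Sum.inr b)
        ⊆ Sum.inr '' H.neighborSet b ∪ {Sum.inl v} := by
      rintro (y | y) hy <;> simp_all [coupling, SimpleGraph.edge_adj]
    calc _ ≤ _ := Set.encard_le_encard this
      _ ≤ _ := Set.encard_union_le _ _
      _ ≤ (e : ℕ∞) + 1 := by
        gcongr
        · exact (Set.encard_image_le _ _).trans (he b)
        · simp
      _ ≤ _ := by norm_cast; omega

theorem uniformlyLocallyFinite_multipleStarRay {n : ℕ} (k : Fin n → ℕ) :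
    UniformlyLocallyFinite (multipleStarRay k) :=
  uniformlyLocallyFinite_coupling (uniformlyLocallyFinite_of_finite _)
    uniformlyLocallyFinite_ray _ _

/-- The adjacency operator of the multiple star with the infinite path attached to its root. -/
def multipleStarRayOperator {n : ℕ} (k : Fin n → ℕ) :
    lp (fun _ : Option (Σ j : Fin n, Fin (k j)) ⊕ ℕ => ℂ) 2 →L[ℂ]
      lp (fun _ : Option (Σ j : Fin n, Fin (k j)) ⊕ ℕ => ℂ) 2 :=
  adjacencyOperator (multipleStarRay k) (uniformlyLocallyFinite_multipleStarRay k)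

/-- The interval `[-2, 2]` as a subset of `ℂ`. -/
def band : Set ℂ :=
  Complex.ofReal '' Set.Icc (-2 : ℝ) 2

/-- The discrete spectrum of a finite graph with a tail: the eigenvalues of finite multiplicity
off `[-2, 2]`. -/
def discreteSpectrum {E : Type*} [NormedAddCommGroup E] [NormedSpace ℂ E] (A : E →L[ℂ] E) :
    Set ℂ :=
  {z | z ∉ band ∧ Module.End.HasEigenvalue (A : Module.End ℂ E) z ∧
    FiniteDimensional ℂ (Module.End.eigenspace (A : Module.End ℂ E) z)}

/-- The equation `∑ⱼ sinh (kⱼ t) / sinh ((kⱼ + 1) t) = exp t`. -/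
def StarEquation {n : ℕ} (k : Fin n → ℕ) (t : ℝ) : Prop :=
  ∑ j, Real.sinh ((k j : ℝ) * t) / Real.sinh (((k j : ℝ) + 1) * t) = Real.exp t

end TailedGraph

end

/-!
The adjacency operator differs by an operator of finite rank from that of the free tail together
with isolated vertices, whose norm is at most `2`. Hence every point of the spectrum outside
`[-2, 2]` is an eigenvalue; it is real and can be written as `x + x⁻¹` with `0 < |x| < 1`. A square
summable solution of the eigenvalue equation must decay like `xᵐ` along the tail, so that the tail
acts on the star as a potential `x` at the root.

On a leg with `k` vertices the solution is determined by its value at the root: its first value is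
`r k / r (k + 1)` times the root value, where `r` solves the recurrence and vanishes just beyond the
free end. The equation at the root then reads `∑ⱼ x * r (k j) / r (k j + 1) = 1`. Its left side
depends only on `q = x²` and increases strictly from `0` at `q = 0` to `∑ⱼ (1 - 1 / (k j + 1))` at
`q = 1`, which exceeds `1` except in the excluded cases. So there is exactly one `q`, hence exactly
two values `x = ±exp (-t)`, and `r m` is proportional to `sinh (m t)`.
-/

noncomputable section

namespace TailedGraph

section Operators

variable {V : Type*}

theorem adjacencyOperator_single [DecidableEq V] (G : SimpleGraph V)
    (h : UniformlyLocallyFinite G) (v : V) :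
    adjacencyOperator G h (lp.single 2 v 1) = ∑ w ∈ h.nbrs v, lp.single 2 w (1 : ℂ) := by
  ext u
  rw [adjacencyOperator_apply, lp.coeFn_sum, Finset.sum_apply]
  simp only [lp.single_apply, Pi.single_apply, Finset.sum_ite_eq, Finset.sum_ite_eq']
  exact if_congr (by rw [h.mem_nbrs, h.mem_nbrs, G.adj_comm]) rfl rfl

theorem isSelfAdjoint_adjacencyOperator (G : SimpleGraph V) (h : UniformlyLocallyFinite G) :
    IsSelfAdjoint (adjacencyOperator G h) := by
  classical
  have coord (g : lp (fun _ : V => ℂ) 2) (w : V) :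
      g w = inner ℂ (lp.single 2 w (1 : ℂ)) g := by
    simp [lp.inner_single_left]
  rw [ContinuousLinearMap.isSelfAdjoint_iff']
  ext f v
  rw [coord, ContinuousLinearMap.adjoint_inner_right, adjacencyOperator_single, sum_inner,
    adjacencyOperator_apply]
  exact Finset.sum_congr rfl fun w _ => (coord f w).symm

theorem UniformlyLocallyFinite.coe_card_nbrs {G : SimpleGraph V} (h : UniformlyLocallyFinite G)
    (v : V) : ((h.nbrs v).card : ℕ∞) = (G.neighborSet v).encard :=
  (h.finite v).encard_eq_coe_toFinset_card.symm

theorem norm_adjacencyOperator_le (G : SimpleGraph V) (h : UniformlyLocallyFinite G) {d : ℕ}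
    (hd : ∀ v, (G.neighborSet v).encard ≤ d) : ‖adjacencyOperator G h‖ ≤ d := by
  have hcard (v : V) : (h.nbrs v).card ≤ d := by
    rw [← Nat.cast_le (α := ℕ∞), h.coe_card_nbrs]
    exact hd v
  exact ContinuousLinearMap.opNorm_le_bound _ (by positivity) fun f =>
    lp.norm_le_of_forall_sum_le (by norm_num) (by positivity) (sum_sq_le h hcard f)

theorem hasEigenvalue_of_mem_spectrum_add {𝕜 E : Type*} [NontriviallyNormedField 𝕜]
    [NormedAddCommGroup E] [NormedSpace 𝕜 E] [CompleteSpace E] {B K : E →L[𝕜] E}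
    (hK : IsCompactOperator K) {z : 𝕜} (hB : z ∈ resolventSet 𝕜 B)
    (hz : z ∈ spectrum 𝕜 (B + K)) :
    Module.End.HasEigenvalue ((B + K : E →L[𝕜] E) : Module.End 𝕜 E) z := by
  obtain ⟨R, hR⟩ := spectrum.mem_resolventSet_iff.1 hB
  have factorization : algebraMap 𝕜 (E →L[𝕜] E) z - (B + K)
      = R * (algebraMap 𝕜 (E →L[𝕜] E) 1 - (↑R⁻¹ : E →L[𝕜] E) * K) := by
    rw [mul_sub, ← mul_assoc, R.mul_inv, one_mul, hR, map_one, mul_one, sub_sub]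
  have hRK : IsCompactOperator ((↑R⁻¹ : E →L[𝕜] E) * K : E →L[𝕜] E) := hK.clm_comp _
  rcases hRK.hasEigenvalue_or_mem_resolventSet one_ne_zero with heigen | hres
  · obtain ⟨f, hf⟩ := heigen.exists_hasEigenvector
    have hRKf : ((↑R⁻¹ : E →L[𝕜] E) * K) f = f := by simpa using hf.apply_eq_smul
    have hzf : (algebraMap 𝕜 (E →L[𝕜] E) z - (B + K)) f = 0 := by
      rw [factorization, mul_apply_eq_comp, sub_apply, hRKf]
      simp
    rw [sub_apply, sub_eq_zero] at hzf
    refine Module.End.hasEigenvalue_of_hasEigenvector (x := f) ⟨?_, hf.2⟩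
    rw [Module.End.mem_eigenspace_iff]
    simpa [Algebra.algebraMap_eq_smul_one] using hzf.symm
  · refine absurd ?_ hz
    rw [spectrum.mem_resolventSet_iff] at hres ⊢
    rw [factorization]
    exact R.isUnit.mul hres

theorem isCompactOperator_of_finite_support {𝕜 F : Type*} [NontriviallyNormedField 𝕜]
    [LocallyCompactSpace 𝕜] [AddCommMonoid F] [TopologicalSpace F] [Module 𝕜 F]
    {p : ℝ≥0∞} [Fact (1 ≤ p)] (K : F →L[𝕜] lp (fun _ : V => 𝕜) p) (S : Finset V)
    (hS : ∀ f, ∀ v ∉ S, K f v = 0) : IsCompactOperator K := by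
  classical
  let P : lp (fun _ : V => 𝕜) p →L[𝕜] lp (fun _ : V => 𝕜) p :=
    ∑ v ∈ S, lp.singleContinuousLinearMap 𝕜 (fun _ => 𝕜) p v ∘L lp.evalCLM 𝕜 (fun _ => 𝕜) p v
  have hP : IsCompactOperator P :=
    Submodule.sum_mem (compactOperator (RingHom.id 𝕜) _ _) fun v _ => by
      exact (isCompactOperator_of_locallyCompactSpace_rng
        (lp.singleContinuousLinearMap 𝕜 (fun _ => 𝕜) p v)).comp_clm (lp.evalCLM 𝕜 (fun _ => 𝕜) p v)
  have hPK : P ∘L K = K := by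
    ext f v
    have hPKf : P (K f) v = if v ∈ S then K f v else 0 := by
      rw [_root_.sum_apply, lp.coeFn_sum, Finset.sum_apply]
      simp only [ContinuousLinearMap.comp_apply, lp.singleContinuousLinearMap_apply,
        lp.single_apply, Pi.single_apply, Finset.sum_ite_eq]
      rfl
    rw [ContinuousLinearMap.comp_apply, hPKf, ite_eq_left_iff]
    exact fun hv => (hS f v hv).symm
  rw [← hPK]
  exact hP.comp_clm K

theorem hasEigenvalue_adjacencyOperator_of_mem_spectrum {G H : SimpleGraph V}
    (hG : UniformlyLocallyFinite G) {d : ℕ} (hd : ∀ v, (H.neighborSet v).encard ≤ d) (S : Finset V)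
    (hS : ∀ v ∉ S, ∀ w, G.Adj v w ↔ H.Adj v w) {z : ℂ} (hdz : d < ‖z‖)
    (hz : z ∈ spectrum ℂ (adjacencyOperator G hG)) :
    Module.End.HasEigenvalue (adjacencyOperator G hG : Module.End ℂ (lp (fun _ : V => ℂ) 2)) z := by
  have hH : UniformlyLocallyFinite H := ⟨d, hd⟩
  have hres : z ∈ resolventSet ℂ (adjacencyOperator H hH) := by
    refine spectrum.mem_resolventSet_of_norm_lt_mul (lt_of_le_of_lt ?_ hdz)
    exact (mul_le_of_le_one_right (norm_nonneg _) ContinuousLinearMap.norm_id_le).trans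
      (norm_adjacencyOperator_le H hH hd)
  have hcompact : IsCompactOperator (adjacencyOperator G hG - adjacencyOperator H hH) := by
    refine isCompactOperator_of_finite_support _ S fun f v hv => ?_
    rw [sub_apply, lp.coeFn_sub, Pi.sub_apply, sub_eq_zero, adjacencyOperator_apply,
      adjacencyOperator_apply]
    refine Finset.sum_congr ?_ fun _ _ => rfl
    ext w
    rw [hG.mem_nbrs, hH.mem_nbrs, hS v hv]
  rw [← add_sub_cancel (adjacencyOperator H hH) (adjacencyOperator G hG)] at hz ⊢
  exact hasEigenvalue_of_mem_spectrum_add hcompact hres hz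

end Operators

section Recurrence

theorem eq_pow_mul_of_tendsto_zero {𝕜 : Type*} [NormedField 𝕜] {x : 𝕜} (hx : x ≠ 0)
    (hx1 : ‖x‖ < 1) {w : ℕ → 𝕜} (hw : ∀ m, w m + w (m + 2) = (x + x⁻¹) * w (m + 1))
    (hlim : Filter.Tendsto w Filter.atTop (nhds 0)) (m : ℕ) : w m = x ^ m * w 0 := by
  -- The defect grows like `x⁻ᵐ` unless it vanishes.
  have hdefect (m : ℕ) : w 1 - x * w 0 = x ^ m * (w (m + 1) - x * w m) := by
    induction m with
    | zero => simp
    | succ m ih =>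
      have hstep : w (m + 1) - x * w m = x * (w (m + 2) - x * w (m + 1)) := by
        linear_combination (-x) * hw m - w (m + 1) * mul_inv_cancel₀ hx
      rw [ih, hstep, pow_succ, mul_assoc]
  have hdefect_lim : Filter.Tendsto (fun m => x ^ m * (w (m + 1) - x * w m)) Filter.atTop
      (nhds 0) := by
    have hpow := tendsto_pow_atTop_nhds_zero_of_norm_lt_one hx1
    simpa using hpow.mul (((Filter.tendsto_add_atTop_iff_nat 1).2 hlim).sub (hlim.const_mul x))
  have hzero : w 1 - x * w 0 = 0 :=
    tendsto_nhds_unique (tendsto_const_nhds.congr hdefect) hdefect_lim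
  have hratio (m : ℕ) : w (m + 1) = x * w m :=
    sub_eq_zero.1 ((mul_eq_zero.1 ((hdefect m).symm.trans hzero)).resolve_left (pow_ne_zero m hx))
  induction m with
  | zero => simp
  | succ m ih => rw [hratio, ih, pow_succ', mul_assoc]

/- Both `u`, read from its zero at `K + 1`, and `r` solve the same symmetric recurrence, so their
discrete Wronskian vanishes. -/
theorem mul_eq_mul_of_recurrence {R : Type*} [CommRing R] {z : R} {K : ℕ} {u r : ℕ → R}
    (hu : ∀ i < K, u i + u (i + 2) = z * u (i + 1)) (hu_end : u (K + 1) = 0)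
    (hr : ∀ m, r m + r (m + 2) = z * r (m + 1)) (hr0 : r 0 = 0) {i m : ℕ} (him : i + m = K) :
    u (i + 1) * r (m + 1) = u i * r m := by
  induction m generalizing i with
  | zero => rw [show i = K from him, hu_end, hr0, zero_mul, mul_zero]
  | succ m ih =>
    have hi := hu i (by omega)
    have ih := ih (i := i + 1) (by omega)
    linear_combination u (i + 1) * hr m - r (m + 1) * hi + ih

end Recurrence

section PathSolution

variable {F : Type*} [Field F]

/-- The solution of the eigenvalue equation `r m + r (m + 2) = (x + x⁻¹) r (m + 1)` on a path that
vanishes at `0`, normalized by `r 1 = x⁻¹`. It equals `(x⁻ᵐ - xᵐ) / (1 - x²)`, written as a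
geometric sum so that `x² = 1` is not exceptional. -/
def pathSolution (x : F) (m : ℕ) : F :=
  (x ^ m)⁻¹ * ∑ i ∈ Finset.range m, (x ^ 2) ^ i

theorem pathSolution_zero (x : F) : pathSolution x 0 = 0 := by
  simp [pathSolution]

theorem pathSolution_add_pathSolution {x : F} (hx : x ≠ 0) (m : ℕ) :
    pathSolution x m + pathSolution x (m + 2) = (x + x⁻¹) * pathSolution x (m + 1) := by
  simp only [pathSolution, Finset.sum_range_succ]
  generalize ∑ i ∈ Finset.range m, (x ^ 2) ^ i = s
  field_simp
  ring

theorem geom_sum_ne_zero_of_norm_lt_one {𝕜 : Type*} [NormedField 𝕜] {q : 𝕜} (hq : ‖q‖ < 1)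
    (m : ℕ) : ∑ i ∈ Finset.range (m + 1), q ^ i ≠ 0 := by
  intro h
  have hpow : q ^ (m + 1) = 1 := by
    rw [← sub_eq_zero, ← geom_sum_mul, h, zero_mul]
  have hnorm : ‖q‖ ^ (m + 1) = 1 := by rw [← norm_pow, hpow, norm_one]
  exact (pow_lt_one₀ (norm_nonneg q) hq m.succ_ne_zero).ne hnorm

theorem pathSolution_div_pathSolution_succ {x : F} (hx : x ≠ 0) {m : ℕ}
    (hm : ∑ i ∈ Finset.range (m + 1), (x ^ 2) ^ i ≠ 0) :
    pathSolution x m / pathSolution x (m + 1)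
      = x⁻¹ * (1 - (∑ i ∈ Finset.range (m + 1), (x ^ 2) ^ i)⁻¹) := by
  have hstep : ∑ i ∈ Finset.range (m + 1), (x ^ 2) ^ i
      = x ^ 2 * ∑ i ∈ Finset.range m, (x ^ 2) ^ i + 1 := geom_sum_succ
  simp only [pathSolution]
  field_simp
  rw [hstep]
  ring

/-- The sum over the legs of the ratios `r (k j) / r (k j + 1)` with `r = pathSolution x`,
multiplied by `x`. It is a function of `q = x²` only. -/
def starSum {n : ℕ} (k : Fin n → ℕ) (q : F) : F :=
  ∑ j, (1 - (∑ i ∈ Finset.range (k j + 1), q ^ i)⁻¹)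

end PathSolution

section PathSolutionNormed

variable {𝕜 : Type*} [NormedField 𝕜] {x : 𝕜}

theorem pathSolution_succ_ne_zero (hx : x ≠ 0) (hx1 : ‖x‖ < 1) (m : ℕ) :
    pathSolution x (m + 1) ≠ 0 :=
  mul_ne_zero (inv_ne_zero (pow_ne_zero _ hx)) (geom_sum_ne_zero_of_norm_lt_one
    (by rw [norm_pow]; exact pow_lt_one₀ (norm_nonneg x) hx1 two_ne_zero) m)

theorem sum_pathSolution_div_pathSolution_succ (hx : x ≠ 0) (hx1 : ‖x‖ < 1) {n : ℕ}
    (k : Fin n → ℕ) :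
    ∑ j, pathSolution x (k j) / pathSolution x (k j + 1) = x⁻¹ * starSum k (x ^ 2) := by
  rw [starSum, Finset.mul_sum]
  refine Finset.sum_congr rfl fun j _ => pathSolution_div_pathSolution_succ hx ?_
  exact right_ne_zero_of_mul (pathSolution_succ_ne_zero hx hx1 (k j))

end PathSolutionNormed

section StarSum

variable {n : ℕ} {k : Fin n → ℕ}

theorem starSum_eq_card_mul {F : Type*} [Field F] {p : ℕ} (hp : ∀ j, k j = p) (q : F) :
    starSum k q = n * (1 - (∑ i ∈ Finset.range (p + 1), q ^ i)⁻¹) := by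
  simp only [starSum, hp, Finset.sum_const, Finset.card_univ, Fintype.card_fin, nsmul_eq_mul]

theorem starSum_zero {F : Type*} [Field F] (k : Fin n → ℕ) : starSum k (0 : F) = 0 := by
  simp [starSum, geom_sum_succ]

theorem starSum_one {F : Type*} [Field F] (k : Fin n → ℕ) :
    starSum k (1 : F) = ∑ j, (1 - ((k j : F) + 1)⁻¹) := by
  simp [starSum]

theorem starSum_ofReal (k : Fin n → ℕ) (q : ℝ) : starSum k (q : ℂ) = (starSum k q : ℝ) := by
  simp [starSum]

theorem continuousOn_starSum (k : Fin n → ℕ) : ContinuousOn (starSum k : ℝ → ℝ) (Set.Ici 0) := by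
  refine continuousOn_finsetSum _ fun j _ => continuousOn_const.sub (ContinuousOn.inv₀ ?_ ?_)
  · fun_prop
  · exact fun q hq => (geom_sum_pos hq (k j).succ_ne_zero).ne'

theorem strictMonoOn_starSum (hk : ∃ j, k j ≠ 0) :
    StrictMonoOn (starSum k : ℝ → ℝ) (Set.Ici 0) := by
  intro a ha b _ hab
  have ha : 0 ≤ a := ha
  have hpow (i : ℕ) : a ^ i ≤ b ^ i := pow_le_pow_left₀ ha hab.le i
  obtain ⟨j₀, hj₀⟩ := hk
  refine Finset.sum_lt_sum (fun j _ => ?_) ⟨j₀, Finset.mem_univ _, ?_⟩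
  · have hpos := geom_sum_pos ha (k j).succ_ne_zero
    have hle : ∑ i ∈ Finset.range (k j + 1), a ^ i ≤ ∑ i ∈ Finset.range (k j + 1), b ^ i :=
      Finset.sum_le_sum fun i _ => hpow i
    gcongr
  · have hpos := geom_sum_pos ha (k j₀).succ_ne_zero
    have hlt : ∑ i ∈ Finset.range (k j₀ + 1), a ^ i < ∑ i ∈ Finset.range (k j₀ + 1), b ^ i :=
      Finset.sum_lt_sum (fun i _ => hpow i)
        ⟨1, Finset.mem_range.2 (by omega), by simpa using hab⟩
    gcongr

theorem existsUnique_starSum_eq_one (h : 1 < starSum k (1 : ℝ)) :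
    ∃! q : ℝ, q ∈ Set.Ioo 0 1 ∧ starSum k q = 1 := by
  have hk : ∃ j, k j ≠ 0 := by
    by_contra! hk
    norm_num [starSum_one, hk] at h
  obtain ⟨q, hq, hq1⟩ := intermediate_value_Ioo zero_le_one
    ((continuousOn_starSum k).mono Set.Icc_subset_Ici_self)
    (show (1 : ℝ) ∈ Set.Ioo (starSum k 0) (starSum k 1) from ⟨by simp [starSum_zero], h⟩)
  refine ⟨q, ⟨hq, hq1⟩, fun q' ⟨hq', hq1'⟩ => ?_⟩
  exact (strictMonoOn_starSum hk).injOn hq'.1.le hq.1.le (hq1'.trans hq1.symm)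

theorem one_lt_starSum_one (hn : 2 ≤ n) (hk : ∀ j, 1 ≤ k j)
    (hne : ¬ (n = 2 ∧ ∀ j, k j = 1)) : 1 < starSum k (1 : ℝ) := by
  have half_le (j : Fin n) : (1 / 2 : ℝ) ≤ 1 - ((k j : ℝ) + 1)⁻¹ := by
    have hj : (1 : ℝ) ≤ k j := by exact_mod_cast hk j
    have hinv : ((k j : ℝ) + 1)⁻¹ ≤ 2⁻¹ := by gcongr; linarith
    linarith
  have sum_half : ∑ _j : Fin n, (1 / 2 : ℝ) = n / 2 := by simp [div_eq_mul_inv]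
  rw [starSum_one]
  rcases hn.lt_or_eq with h3 | rfl
  · calc (1 : ℝ) < n / 2 := by
          have : (3 : ℝ) ≤ n := by exact_mod_cast h3
          linarith
      _ = ∑ _j : Fin n, (1 / 2 : ℝ) := sum_half.symm
      _ ≤ ∑ j, (1 - ((k j : ℝ) + 1)⁻¹) := Finset.sum_le_sum fun j _ => half_le j
  · obtain ⟨j, hj⟩ : ∃ j, k j ≠ 1 := not_forall.1 fun h => hne ⟨rfl, h⟩
    have half_lt : (1 / 2 : ℝ) < 1 - ((k j : ℝ) + 1)⁻¹ := by
      have hj2 : (2 : ℝ) ≤ k j := by exact_mod_cast (hk j).lt_of_ne' hj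
      have hinv : ((k j : ℝ) + 1)⁻¹ < 2⁻¹ := by gcongr; linarith
      linarith
    calc (1 : ℝ) = ∑ _j : Fin 2, (1 / 2 : ℝ) := by norm_num
      _ < ∑ j, (1 - ((k j : ℝ) + 1)⁻¹) :=
        Finset.sum_lt_sum (fun j _ => half_le j) ⟨j, Finset.mem_univ _, half_lt⟩

end StarSum

section StarEquation

variable {n : ℕ} {k : Fin n → ℕ} {t : ℝ}

theorem sinh_natCast_mul_eq_pathSolution (t : ℝ) (m : ℕ) :
    Real.sinh (m * t) = (1 - Real.exp (-t) ^ 2) / 2 * pathSolution (Real.exp (-t)) m := by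
  have hgeom := geom_sum_mul (Real.exp (-t) ^ 2) m
  have hinv : Real.exp (m * t) = (Real.exp (-t) ^ m)⁻¹ := by
    rw [← Real.exp_nat_mul, mul_neg, Real.exp_neg, inv_inv]
  rw [Real.sinh_eq, ← mul_neg, Real.exp_nat_mul (-t), hinv, pathSolution]
  field_simp
  linear_combination hgeom

theorem exp_neg_sq_lt_one (ht : 0 < t) : Real.exp (-t) ^ 2 < 1 :=
  pow_lt_one₀ (Real.exp_pos _).le (Real.exp_lt_one_iff.2 (neg_lt_zero.2 ht)) two_ne_zero

theorem starEquation_iff_starSum_eq_one (ht : 0 < t) :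
    StarEquation k t ↔ starSum k (Real.exp (-t) ^ 2) = 1 := by
  have hratio (m : ℕ) : Real.sinh (m * t) / Real.sinh ((m + 1) * t)
      = Real.exp t * (1 - (∑ i ∈ Finset.range (m + 1), (Real.exp (-t) ^ 2) ^ i)⁻¹) := by
    have hgeom := (geom_sum_pos (sq_nonneg (Real.exp (-t))) m.succ_ne_zero).ne'
    have hfactor : (1 - Real.exp (-t) ^ 2) / 2 ≠ 0 := by
      linarith [exp_neg_sq_lt_one ht]
    rw [← Nat.cast_add_one, sinh_natCast_mul_eq_pathSolution, sinh_natCast_mul_eq_pathSolution,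
      mul_div_mul_left _ _ hfactor, pathSolution_div_pathSolution_succ (Real.exp_ne_zero _) hgeom,
      Real.exp_neg, inv_inv]
  simp only [StarEquation, hratio]
  rw [← Finset.mul_sum, mul_eq_left₀ (Real.exp_ne_zero t)]
  rfl

theorem existsUnique_starEquation (h : 1 < starSum k (1 : ℝ)) :
    ∃! t : ℝ, 0 < t ∧ StarEquation k t := by
  obtain ⟨q, ⟨⟨hq0, hq1⟩, hq⟩, hunique⟩ := existsUnique_starSum_eq_one h
  have hexp (t : ℝ) : Real.exp (-t) ^ 2 = q ↔ t = -Real.log q / 2 := by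
    rw [← Real.exp_nat_mul, ← Real.exp_log hq0, Real.exp_eq_exp, Real.log_exp, Nat.cast_two]
    constructor <;> intro h <;> linarith
  have hpos : 0 < -Real.log q / 2 := by linarith [Real.log_neg hq0 hq1]
  refine ⟨-Real.log q / 2, ⟨hpos, ?_⟩, fun t ⟨ht, hstar⟩ => (hexp t).1 (hunique _ ⟨⟨?_, ?_⟩, ?_⟩)⟩
  · rwa [starEquation_iff_starSum_eq_one hpos, (hexp _).2 rfl]
  · positivity
  · exact exp_neg_sq_lt_one ht
  · exact (starEquation_iff_starSum_eq_one ht).1 hstar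

theorem starEquation_iff_of_forall_eq {p : ℕ} (hp : ∀ j, k j = p) (ht : 0 < t) :
    StarEquation k t ↔
      ((n : ℝ) - 1) * Real.exp (-t) ^ (2 * p + 2) - (n : ℝ) * Real.exp (-t) ^ 2 + 1 = 0 := by
  rw [starEquation_iff_starSum_eq_one ht, starSum_eq_card_mul hp]
  have hq : Real.exp (-t) ^ 2 < 1 := exp_neg_sq_lt_one ht
  have hq0 : 0 < Real.exp (-t) ^ 2 := by positivity
  rw [show 2 * p + 2 = 2 * (p + 1) by ring, pow_mul]
  generalize Real.exp (-t) ^ 2 = q at hq hq0 ⊢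
  have hsum := geom_sum_mul q (p + 1)
  have hpos := geom_sum_pos hq0.le p.succ_ne_zero
  generalize ∑ i ∈ Finset.range (p + 1), q ^ i = s at hsum hpos
  have hclear : ((n : ℝ) - 1) * q ^ (p + 1) - n * q + 1
      = (q - 1) * s * (n * (1 - s⁻¹) - 1) := by
    have := mul_inv_cancel₀ hpos.ne'
    linear_combination (1 - (n : ℝ)) * hsum + n * (q - 1) * this
  rw [hclear, mul_eq_zero, or_iff_right (mul_ne_zero (sub_ne_zero.2 hq.ne) hpos.ne'), sub_eq_zero]

end StarEquation

section Neighbours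

variable {V W M : Type*} [AddCommMonoid M]

theorem sum_nbrs_coupling_inl [DecidableEq V] {G : SimpleGraph V} {H : SimpleGraph W}
    (hG : UniformlyLocallyFinite G) {v : V} {w : W}
    (h : UniformlyLocallyFinite (coupling G H v w)) (F : V ⊕ W → M) (a : V) :
    ∑ b ∈ h.nbrs (Sum.inl a), F b
      = ∑ b ∈ hG.nbrs a, F (Sum.inl b) + if a = v then F (Sum.inr w) else 0 := by
  have hnbrs : h.nbrs (Sum.inl a) = (hG.nbrs a).disjSum (if a = v then {w} else ∅) := by
    ext (b | b) <;> rw [h.mem_nbrs] <;> by_cases hav : a = v <;>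
      simp [hav, hG.mem_nbrs, coupling, SimpleGraph.edge_adj]
  rw [hnbrs, Finset.sum_disjSum]
  split_ifs <;> simp

theorem sum_nbrs_coupling_inr [DecidableEq W] {G : SimpleGraph V} {H : SimpleGraph W}
    (hH : UniformlyLocallyFinite H) {v : V} {w : W}
    (h : UniformlyLocallyFinite (coupling G H v w)) (F : V ⊕ W → M) (b : W) :
    ∑ a ∈ h.nbrs (Sum.inr b), F a
      = (if b = w then F (Sum.inl v) else 0) + ∑ a ∈ hH.nbrs b, F (Sum.inr a) := by
  have hnbrs : h.nbrs (Sum.inr b) = (if b = w then {v} else ∅ : Finset V).disjSum (hH.nbrs b) := by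
    ext (a | a) <;> rw [h.mem_nbrs] <;> by_cases hbw : b = w <;>
      simp [hbw, hH.mem_nbrs, coupling, SimpleGraph.edge_adj]
  rw [hnbrs, Finset.sum_disjSum]
  split_ifs <;> simp

theorem ray_adj {a b : ℕ} : ray.Adj a b ↔ a + 1 = b ∨ b + 1 = a := by
  rw [ray, SimpleGraph.hasse_adj, Nat.covBy_iff_add_one_eq, Nat.covBy_iff_add_one_eq]

theorem nbrs_ray_zero : uniformlyLocallyFinite_ray.nbrs 0 = {1} := by
  ext b
  rw [UniformlyLocallyFinite.mem_nbrs, ray_adj, Finset.mem_singleton]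
  omega

theorem nbrs_ray_succ (m : ℕ) : uniformlyLocallyFinite_ray.nbrs (m + 1) = {m, m + 2} := by
  ext b
  rw [UniformlyLocallyFinite.mem_nbrs, ray_adj, Finset.mem_insert, Finset.mem_singleton]
  omega

theorem encard_neighborSet_ray_le (m : ℕ) : (ray.neighborSet m).encard ≤ 2 := by
  rw [← uniformlyLocallyFinite_ray.coe_card_nbrs]
  cases m with
  | zero => simp [nbrs_ray_zero]
  | succ m => exact_mod_cast (nbrs_ray_succ m).symm ▸ Finset.card_le_two

theorem encard_neighborSet_bot_sum_ray_le (a : V ⊕ ℕ) :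
    ((SimpleGraph.sum (⊥ : SimpleGraph V) ray).neighborSet a).encard ≤ 2 := by
  rcases a with a | m
  · simp [SimpleGraph.neighborSet_sum_inl]
  · rw [SimpleGraph.neighborSet_sum_inr]
    exact (Set.encard_image_le _ _).trans (encard_neighborSet_ray_le m)

end Neighbours

section Tail

variable {V : Type*} {G : SimpleGraph V} {v : V}

/-- The values of `f` along the tail, where the vertex `v` carrying the tail has index `0`. -/
def tailValues (v : V) (f : V ⊕ ℕ → ℂ) : ℕ → ℂ
  | 0 => f (Sum.inl v)
  | m + 1 => f (Sum.inr m)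

theorem adjacencyOperator_coupling_ray_inr (h : UniformlyLocallyFinite (coupling G ray v 0))
    (f : lp (fun _ : V ⊕ ℕ => ℂ) 2) (m : ℕ) :
    adjacencyOperator (coupling G ray v 0) h f (Sum.inr m)
      = tailValues v f m + tailValues v f (m + 2) := by
  rw [adjacencyOperator_apply, sum_nbrs_coupling_inr uniformlyLocallyFinite_ray]
  cases m with
  | zero => simp [nbrs_ray_zero, tailValues]
  | succ m => simp [nbrs_ray_succ, tailValues]

theorem tendsto_tailValues (v : V) (f : lp (fun _ : V ⊕ ℕ => ℂ) 2) :
    Filter.Tendsto (tailValues v f) Filter.atTop (nhds 0) := by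
  have hsummable : Summable fun a => ‖f a‖ ^ 2 := by
    simpa using (lp.memℓp f).summable (by norm_num)
  have hsqrt := (hsummable.comp_injective Sum.inr_injective).tendsto_atTop_zero.sqrt
  simp only [Function.comp_apply, Real.sqrt_sq (norm_nonneg _), Real.sqrt_zero] at hsqrt
  exact (Filter.tendsto_add_atTop_iff_nat 1).1 (tendsto_zero_iff_norm_tendsto_zero.2 hsqrt)

/-- The extension of a function on the vertices of a finite graph to the tail at `v`, decaying
geometrically at rate `x`. -/
def tailExtension (v : V) (x : ℂ) (g : V → ℂ) : V ⊕ ℕ → ℂ :=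
  Sum.elim g fun m => x ^ (m + 1) * g v

theorem tailValues_tailExtension (v : V) (x : ℂ) (g : V → ℂ) (m : ℕ) :
    tailValues v (tailExtension v x g) m = x ^ m * g v := by
  cases m <;> simp [tailValues, tailExtension]

theorem memℓp_tailExtension [Finite V] (v : V) {x : ℂ} (hx1 : ‖x‖ < 1) (g : V → ℂ) :
    Memℓp (tailExtension v x g) 2 := by
  have hx2 : ‖x‖ ^ 2 < 1 := pow_lt_one₀ (norm_nonneg x) hx1 two_ne_zero
  refine memℓp_gen (Summable.sum _ Summable.of_finite ?_)
  refine ((summable_geometric_of_lt_one (sq_nonneg _) hx2).mul_left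
    (‖x‖ ^ 2 * ‖g v‖ ^ 2)).congr fun m => ?_
  simp only [tailExtension, Function.comp_apply, Sum.elim_inr, norm_mul, norm_pow,
    ENNReal.toReal_ofNat, Real.rpow_ofNat]
  ring

variable [DecidableEq V]

/-- The eigenvalue equation at energy `x + x⁻¹` on a finite graph `G` with a tail at `v`, after
the tail has been eliminated: its effect is the additional potential `x` at `v`. -/
def IsEffectiveSolution [Finite V] (G : SimpleGraph V) (v : V) (x : ℂ) (g : V → ℂ) : Prop :=
  ∀ a, (∑ b ∈ (uniformlyLocallyFinite_of_finite G).nbrs a, g b + if a = v then x * g v else 0)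
    = (x + x⁻¹) * g a

variable [Finite V] (h : UniformlyLocallyFinite (coupling G ray v 0)) {x : ℂ}

theorem adjacencyOperator_coupling_ray_eq_smul_iff (hx : x ≠ 0) (hx1 : ‖x‖ < 1)
    (f : lp (fun _ : V ⊕ ℕ => ℂ) 2) :
    adjacencyOperator (coupling G ray v 0) h f = (x + x⁻¹) • f ↔
      IsEffectiveSolution G v x (f ∘ Sum.inl) ∧ ⇑f = tailExtension v x (f ∘ Sum.inl) := by
  have htail : (∀ m, tailValues v f m + tailValues v f (m + 2) = (x + x⁻¹) * tailValues v f (m + 1))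
      ↔ ⇑f = tailExtension v x (f ∘ Sum.inl) := by
    constructor
    · intro hrec
      ext (a | m)
      · rfl
      · exact eq_pow_mul_of_tendsto_zero hx hx1 hrec (tendsto_tailValues v f) (m + 1)
    · intro hf m
      rw [hf]
      simp only [tailValues_tailExtension]
      field_simp
      ring
  have hval : adjacencyOperator (coupling G ray v 0) h f = (x + x⁻¹) • f ↔
      (∀ a, (∑ b ∈ (uniformlyLocallyFinite_of_finite G).nbrs a, f (Sum.inl b)
        + if a = v then f (Sum.inr 0) else 0) = (x + x⁻¹) * f (Sum.inl a)) ∧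
      ∀ m, tailValues v f m + tailValues v f (m + 2) = (x + x⁻¹) * tailValues v f (m + 1) := by
    rw [lp.ext_iff, funext_iff, Sum.forall]
    refine and_congr (forall_congr' fun a => ?_) (forall_congr' fun m => ?_)
    · rw [adjacencyOperator_apply, sum_nbrs_coupling_inl (uniformlyLocallyFinite_of_finite G)]
      rfl
    · rw [adjacencyOperator_coupling_ray_inr]
      rfl
  rw [hval, htail]
  refine and_congr_left fun hf => ?_
  have h0 : f (Sum.inr 0) = x * f (Sum.inl v) := by
    simpa [tailExtension] using congrFun hf (Sum.inr 0)
  rw [h0]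
  rfl

theorem hasEigenvalue_coupling_ray_iff (hx : x ≠ 0) (hx1 : ‖x‖ < 1) :
    Module.End.HasEigenvalue
        (adjacencyOperator (coupling G ray v 0) h : Module.End ℂ (lp (fun _ : V ⊕ ℕ => ℂ) 2))
        (x + x⁻¹) ↔
      ∃ g, g ≠ 0 ∧ IsEffectiveSolution G v x g := by
  constructor
  · intro heigen
    obtain ⟨f, hf⟩ := heigen.exists_hasEigenvector
    obtain ⟨hg, hext⟩ :=
      (adjacencyOperator_coupling_ray_eq_smul_iff h hx hx1 f).1 hf.apply_eq_smul
    refine ⟨f ∘ Sum.inl, fun h0 => hf.2 ?_, hg⟩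
    ext a
    rw [hext, h0]
    cases a <;> simp [tailExtension]
  · rintro ⟨g, hg0, hg⟩
    let f : lp (fun _ : V ⊕ ℕ => ℂ) 2 := ⟨tailExtension v x g, memℓp_tailExtension v hx1 g⟩
    have hf : adjacencyOperator (coupling G ray v 0) h f = (x + x⁻¹) • f :=
      (adjacencyOperator_coupling_ray_eq_smul_iff h hx hx1 f).2 ⟨hg, rfl⟩
    refine Module.End.hasEigenvalue_of_hasEigenvector (x := f)
      ⟨Module.End.mem_eigenspace_iff.2 hf, fun h0 => hg0 ?_⟩
    ext a
    exact congrArg (fun f : lp (fun _ : V ⊕ ℕ => ℂ) 2 => f (Sum.inl a)) h0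

end Tail

section Band

theorem ofReal_notMem_band {a : ℝ} : (a : ℂ) ∉ band ↔ 2 < |a| := by
  simp [band, ← abs_le]

theorem two_lt_abs_iff_exists_add_inv {a : ℝ} :
    2 < |a| ↔ ∃ x : ℝ, x ≠ 0 ∧ |x| < 1 ∧ x + x⁻¹ = a := by
  constructor
  · intro ha
    obtain ⟨y, hy0, hy1, hy⟩ : ∃ y : ℝ, 0 < y ∧ y < 1 ∧ y + y⁻¹ = |a| := by
      refine ⟨Real.exp (-Real.arcosh (|a| / 2)), Real.exp_pos _, ?_, ?_⟩
      · exact Real.exp_lt_one_iff.2 (neg_lt_zero.2 (Real.arcosh_pos (by linarith)))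
      · have hcosh := Real.cosh_arcosh (x := |a| / 2) (by linarith)
        rw [Real.cosh_eq] at hcosh
        rw [← Real.exp_neg, neg_neg]
        linarith
    rcases abs_choice a with h | h
    · exact ⟨y, hy0.ne', by rwa [abs_of_pos hy0], hy.trans h⟩
    · refine ⟨-y, neg_ne_zero.2 hy0.ne', by rwa [abs_neg, abs_of_pos hy0], ?_⟩
      rw [inv_neg, ← neg_add, hy, h, neg_neg]
  · rintro ⟨x, hx, hx1, rfl⟩
    have hsub : x - x⁻¹ ≠ 0 := by
      have hx2 : x ^ 2 < 1 := (sq_lt_one_iff_abs_lt_one x).2 hx1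
      intro h
      have hinv := mul_inv_cancel₀ hx
      rw [← sub_eq_zero.1 h] at hinv
      linarith [sq x]
    have hsq : (x + x⁻¹) ^ 2 = 2 ^ 2 + (x - x⁻¹) ^ 2 := by
      field_simp
      ring
    rw [← abs_two, ← sq_lt_sq, hsq]
    exact lt_add_of_pos_right _ (by positivity)

end Band

section TailSpectrum

variable {V : Type*} [Finite V] {G : SimpleGraph V} {v : V}
  (h : UniformlyLocallyFinite (coupling G ray v 0))

theorem finiteDimensional_eigenspace_coupling_ray {x : ℂ} (hx : x ≠ 0) (hx1 : ‖x‖ < 1) :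
    FiniteDimensional ℂ (Module.End.eigenspace
      (adjacencyOperator (coupling G ray v 0) h : Module.End ℂ (lp (fun _ : V ⊕ ℕ => ℂ) 2))
      (x + x⁻¹)) := by
  classical
  let restrict : lp (fun _ : V ⊕ ℕ => ℂ) 2 →ₗ[ℂ] V → ℂ :=
    LinearMap.pi fun a => lp.evalₗ (fun _ => ℂ) 2 (Sum.inl a)
  refine FiniteDimensional.of_injective (restrict.domRestrict _) ?_
  intro f₁ f₂ h12
  have hext (f : Module.End.eigenspace (adjacencyOperator (coupling G ray v 0) h :
      Module.End ℂ (lp (fun _ : V ⊕ ℕ => ℂ) 2)) (x + x⁻¹)) :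
      ⇑f.1 = tailExtension v x (restrict f.1) :=
    ((adjacencyOperator_coupling_ray_eq_smul_iff h hx hx1 f.1).1
      (Module.End.mem_eigenspace_iff.1 f.2)).2
  apply Subtype.ext
  apply Subtype.ext
  rw [hext f₁, hext f₂]
  exact congrArg (tailExtension v x) h12

theorem hasEigenvalue_coupling_ray_of_mem_spectrum {z : ℂ} (hz2 : 2 < ‖z‖)
    (hz : z ∈ spectrum ℂ (adjacencyOperator (coupling G ray v 0) h)) :
    Module.End.HasEigenvalue
      (adjacencyOperator (coupling G ray v 0) h : Module.End ℂ (lp (fun _ : V ⊕ ℕ => ℂ) 2)) z := by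
  classical
  have := Fintype.ofFinite V
  refine hasEigenvalue_adjacencyOperator_of_mem_spectrum h encard_neighborSet_bot_sum_ray_le
    (insert (Sum.inr 0) (Finset.univ.image Sum.inl)) ?_ (by exact_mod_cast hz2) hz
  rintro (a | m) ha (b | b)
  all_goals simp_all [coupling, SimpleGraph.edge_adj]

theorem mem_spectrum_coupling_ray_diff_band_iff {z : ℂ} :
    z ∈ spectrum ℂ (adjacencyOperator (coupling G ray v 0) h) \ band ↔
      ∃ x : ℝ, x ≠ 0 ∧ |x| < 1 ∧ z = x + (x : ℂ)⁻¹ ∧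
        Module.End.HasEigenvalue (adjacencyOperator (coupling G ray v 0) h :
          Module.End ℂ (lp (fun _ : V ⊕ ℕ => ℂ) 2)) z := by
  constructor
  · rintro ⟨hz, hband⟩
    have hre := (isSelfAdjoint_adjacencyOperator _ h).mem_spectrum_eq_re hz
    have hre2 : 2 < |z.re| := ofReal_notMem_band.1 (hre ▸ hband)
    obtain ⟨x, hx, hx1, hxz⟩ := two_lt_abs_iff_exists_add_inv.1 hre2
    refine ⟨x, hx, hx1, ?_, hasEigenvalue_coupling_ray_of_mem_spectrum h ?_ hz⟩
    · rw [hre, ← hxz]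
      push_cast
      rfl
    · rwa [hre, Complex.norm_real]
  · rintro ⟨x, hx, hx1, rfl, heigen⟩
    constructor
    · rw [ContinuousLinearMap.spectrum_eq]
      exact heigen.mem_spectrum
    · exact_mod_cast ofReal_notMem_band.2 (two_lt_abs_iff_exists_add_inv.2 ⟨x, hx, hx1, rfl⟩)

theorem discreteSpectrum_coupling_ray :
    discreteSpectrum (adjacencyOperator (coupling G ray v 0) h)
      = spectrum ℂ (adjacencyOperator (coupling G ray v 0) h) \ band := by
  ext z
  constructor
  · rintro ⟨hband, heigen, -⟩
    rw [ContinuousLinearMap.spectrum_eq]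
    exact ⟨heigen.mem_spectrum, hband⟩
  · intro hz
    obtain ⟨x, hx, hx1, rfl, heigen⟩ := (mem_spectrum_coupling_ray_diff_band_iff h).1 hz
    exact ⟨hz.2, heigen, finiteDimensional_eigenspace_coupling_ray h (Complex.ofReal_ne_zero.2 hx)
      (by rwa [Complex.norm_real])⟩

end TailSpectrum

section Star

variable {n : ℕ} {k : Fin n → ℕ}

theorem multipleStar_adj_none_some {j : Fin n} {i : Fin (k j)} :
    (multipleStar k).Adj none (some ⟨j, i⟩) ↔ i.val = 0 := by
  simp only [multipleStar, SimpleGraph.fromRel_adj]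
  constructor
  · rintro ⟨-, (⟨_, _, -, h, h0⟩ | ⟨_, _, _, h, -⟩) | (⟨_, _, h, -⟩ | ⟨_, _, _, -, h, -⟩)⟩
    · cases h
      exact h0
    all_goals simp at h
  · exact fun h => ⟨by simp, Or.inl (Or.inl ⟨j, i, trivial, rfl, h⟩)⟩

theorem multipleStar_adj_some_some {j j' : Fin n} {i : Fin (k j)} {i' : Fin (k j')} :
    (multipleStar k).Adj (some ⟨j, i⟩) (some ⟨j', i'⟩) ↔
      j = j' ∧ (i'.val = i.val + 1 ∨ i.val = i'.val + 1) := by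
  simp only [multipleStar, SimpleGraph.fromRel_adj]
  constructor
  · rintro ⟨-, (⟨_, _, h, -⟩ | ⟨_, _, _, h, h', hi⟩) | (⟨_, _, h, -⟩ | ⟨_, _, _, h, h', hi⟩)⟩
    · simp at h
    · cases h
      cases h'
      exact ⟨rfl, Or.inl hi⟩
    · simp at h
    · cases h
      cases h'
      exact ⟨rfl, Or.inr hi⟩
  · rintro ⟨rfl, hi⟩
    refine ⟨fun h => ?_, hi.imp (fun hi => Or.inr ⟨j, i, i', rfl, rfl, hi⟩)
      (fun hi => Or.inr ⟨j, i', i, rfl, rfl, hi⟩)⟩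
    cases h
    omega

/-- The values of `g` along the `j`-th leg of the star, starting from the root and extended by
zero beyond the end of the leg. -/
def legValues {M : Type*} [Zero M] (g : Option (Σ j : Fin n, Fin (k j)) → M) (j : Fin n) : ℕ → M
  | 0 => g none
  | m + 1 => if h : m < k j then g (some ⟨j, m, h⟩) else 0

variable {M : Type*} [AddCommMonoid M]

theorem sum_fin_ite_val_eq {K : ℕ} (F : Fin K → M) (m : ℕ) :
    (∑ i, if i.val = m then F i else 0) = if h : m < K then F ⟨m, h⟩ else 0 := by
  split_ifs with h
  · simp [← Fin.ext_iff (b := ⟨m, h⟩)]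
  · exact Finset.sum_eq_zero fun i _ => if_neg fun hi : i.val = m => h (hi ▸ i.isLt)

open Classical in
theorem sum_nbrs_eq_sum_ite {V : Type*} [Fintype V] {G : SimpleGraph V}
    (h : UniformlyLocallyFinite G) (F : V → M) (a : V) :
    ∑ b ∈ h.nbrs a, F b = ∑ b, if G.Adj a b then F b else 0 := by
  rw [← Finset.sum_filter]
  congr 1
  ext b
  simp [h.mem_nbrs]

theorem sum_nbrs_multipleStar_none (h : UniformlyLocallyFinite (multipleStar k))
    (g : Option (Σ j : Fin n, Fin (k j)) → M) :
    ∑ b ∈ h.nbrs none, g b = ∑ j, legValues g j 1 := by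
  classical
  rw [sum_nbrs_eq_sum_ite, Fintype.sum_option, Fintype.sum_sigma, if_neg (SimpleGraph.irrefl _),
    zero_add]
  simp only [multipleStar_adj_none_some, sum_fin_ite_val_eq]
  rfl

theorem sum_nbrs_multipleStar_some (h : UniformlyLocallyFinite (multipleStar k))
    (g : Option (Σ j : Fin n, Fin (k j)) → M) (j : Fin n) (i : Fin (k j)) :
    ∑ b ∈ h.nbrs (some ⟨j, i⟩), g b = legValues g j i + legValues g j (i + 2) := by
  classical
  rw [sum_nbrs_eq_sum_ite, Fintype.sum_option, Fintype.sum_sigma, Finset.sum_eq_single j]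
  · simp only [(multipleStar k).adj_comm _ none, multipleStar_adj_none_some,
      multipleStar_adj_some_some, true_and]
    have hsplit (i' : Fin (k j)) :
        (if i'.val = i.val + 1 ∨ i.val = i'.val + 1 then g (some ⟨j, i'⟩) else 0)
          = (if i'.val = i.val + 1 then g (some ⟨j, i'⟩) else 0)
            + if i.val = i'.val + 1 then g (some ⟨j, i'⟩) else 0 := by
      split_ifs <;> first | omega | simp
    simp only [hsplit, Finset.sum_add_distrib, sum_fin_ite_val_eq]
    rcases i with ⟨_ | i, hi⟩
    · simp [legValues]
    · simp [legValues, eq_comm (a := i), sum_fin_ite_val_eq, Nat.lt_of_succ_lt hi, add_comm]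
  · intro j' _ hj
    simp [multipleStar_adj_some_some, hj.symm]
  · simp

end Star

section StarSolutions

variable {n : ℕ} {k : Fin n → ℕ} {x : ℂ} {g : Option (Σ j : Fin n, Fin (k j)) → ℂ}

theorem isEffectiveSolution_multipleStar_iff :
    IsEffectiveSolution (multipleStar k) none x g ↔
      ∑ j, legValues g j 1 = x⁻¹ * g none ∧
        ∀ j, ∀ i < k j,
          legValues g j i + legValues g j (i + 2) = (x + x⁻¹) * legValues g j (i + 1) := by
  have hroot (s : ℂ) : s + x * g none = (x + x⁻¹) * g none ↔ s = x⁻¹ * g none := by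
    rw [add_mul, add_comm (x * g none), add_left_inj]
  have hleg (j : Fin n) {i : ℕ} (hi : i < k j) : g (some ⟨j, i, hi⟩) = legValues g j (i + 1) :=
    (dif_pos hi : legValues g j (i + 1) = _).symm
  simp only [IsEffectiveSolution, Option.forall, Sigma.forall, Fin.forall_iff,
    sum_nbrs_multipleStar_none, sum_nbrs_multipleStar_some, hroot, hleg, if_true, reduceCtorEq,
    if_false, add_zero]

theorem legValues_end (j : Fin n) : legValues g j (k j + 1) = 0 :=
  dif_neg (lt_irrefl _)

theorem IsEffectiveSolution.legValues_succ_mul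
    (hg : IsEffectiveSolution (multipleStar k) none x g) (hx : x ≠ 0) {j : Fin n} {i m : ℕ}
    (him : i + m = k j) :
    legValues g j (i + 1) * pathSolution x (m + 1) = legValues g j i * pathSolution x m :=
  mul_eq_mul_of_recurrence ((isEffectiveSolution_multipleStar_iff.1 hg).2 j) (legValues_end j)
    (pathSolution_add_pathSolution hx) (pathSolution_zero x) him

theorem IsEffectiveSolution.root_ne_zero
    (hg : IsEffectiveSolution (multipleStar k) none x g) (hx : x ≠ 0) (hx1 : ‖x‖ < 1)
    (hg0 : g ≠ 0) : g none ≠ 0 := by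
  intro hroot
  have hleg (j : Fin n) {i : ℕ} (hi : i ≤ k j) : legValues g j i = 0 := by
    induction i with
    | zero => exact hroot
    | succ i ih =>
      have hstep := hg.legValues_succ_mul hx (Nat.add_sub_of_le (Nat.le_of_succ_le hi))
      rw [ih (Nat.le_of_succ_le hi), zero_mul] at hstep
      exact (mul_eq_zero.1 hstep).resolve_right (pathSolution_succ_ne_zero hx hx1 _)
  refine hg0 (funext ?_)
  rintro (_ | ⟨j, i⟩)
  · exact hroot
  · simpa [legValues] using hleg j i.isLt

/-- The function on the star that equals `1` at the root and is proportional to `pathSolution x`,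
read from the free end, along each leg. -/
def starSolution (k : Fin n → ℕ) (x : ℂ) : Option (Σ j : Fin n, Fin (k j)) → ℂ
  | none => 1
  | some ⟨j, i⟩ => pathSolution x (k j - i) / pathSolution x (k j + 1)

theorem legValues_starSolution (hx : x ≠ 0) (hx1 : ‖x‖ < 1) {j : Fin n} {i : ℕ}
    (hi : i ≤ k j + 1) :
    legValues (starSolution k x) j i = pathSolution x (k j + 1 - i) / pathSolution x (k j + 1) := by
  rcases i with _ | i
  · exact (div_self (pathSolution_succ_ne_zero hx hx1 _)).symm
  · rw [Nat.add_sub_add_right]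
    rcases Nat.lt_or_eq_of_le (Nat.le_of_succ_le_succ hi) with hlt | rfl
    · exact dif_pos hlt
    · rw [legValues_end, Nat.sub_self, pathSolution_zero, zero_div]

theorem exists_isEffectiveSolution_multipleStar_iff (hx : x ≠ 0) (hx1 : ‖x‖ < 1) :
    (∃ g, g ≠ 0 ∧ IsEffectiveSolution (multipleStar k) none x g) ↔ starSum k (x ^ 2) = 1 := by
  constructor
  · rintro ⟨g, hg0, hg⟩
    have hleg (j : Fin n) : legValues g j 1
        = g none * (pathSolution x (k j) / pathSolution x (k j + 1)) := by
      rw [← mul_div_assoc, eq_div_iff (pathSolution_succ_ne_zero hx hx1 _)]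
      exact hg.legValues_succ_mul hx (zero_add _)
    have hroot := (isEffectiveSolution_multipleStar_iff.1 hg).1
    simp only [hleg] at hroot
    rw [← Finset.mul_sum, sum_pathSolution_div_pathSolution_succ hx hx1, mul_comm] at hroot
    refine mul_left_cancel₀ (inv_ne_zero hx) ?_
    rw [mul_one]
    exact mul_right_cancel₀ (hg.root_ne_zero hx hx1 hg0) hroot
  · intro hstar
    refine ⟨starSolution k x, fun h => one_ne_zero (congrFun h none),
      isEffectiveSolution_multipleStar_iff.2 ⟨?_, fun j i hi => ?_⟩⟩
    · simp only [legValues_starSolution hx hx1 (Nat.le_add_left 1 _), Nat.add_sub_cancel]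
      rw [sum_pathSolution_div_pathSolution_succ hx hx1, hstar]
      rfl
    · obtain ⟨m, hm⟩ := Nat.exists_eq_add_of_lt hi
      rw [legValues_starSolution hx hx1 (by omega), legValues_starSolution hx hx1 (by omega),
        legValues_starSolution hx hx1 (by omega), show k j + 1 - i = m + 2 by omega,
        show k j + 1 - (i + 1) = m + 1 by omega, show k j + 1 - (i + 2) = m by omega,
        ← add_div, add_comm, pathSolution_add_pathSolution hx, mul_div_assoc]

theorem hasEigenvalue_multipleStarRayOperator_iff (hx : x ≠ 0) (hx1 : ‖x‖ < 1) :
    Module.End.HasEigenvalue (multipleStarRayOperator k :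
        Module.End ℂ (lp (fun _ : Option (Σ j : Fin n, Fin (k j)) ⊕ ℕ => ℂ) 2)) (x + x⁻¹) ↔
      starSum k (x ^ 2) = 1 :=
  (hasEigenvalue_coupling_ray_iff (uniformlyLocallyFinite_multipleStarRay k) hx hx1).trans
    (exists_isEffectiveSolution_multipleStar_iff hx hx1)

end StarSolutions

section StarSpectrum

variable {n : ℕ} {k : Fin n → ℕ}

theorem mem_spectrum_multipleStarRayOperator_diff_band_iff {z : ℂ} :
    z ∈ spectrum ℂ (multipleStarRayOperator k) \ band ↔
      ∃ x : ℝ, x ≠ 0 ∧ |x| < 1 ∧ starSum k (x ^ 2) = 1 ∧ z = ((x + x⁻¹ : ℝ) : ℂ) := by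
  refine (mem_spectrum_coupling_ray_diff_band_iff _).trans (exists_congr fun x =>
    and_congr_right fun hx => and_congr_right fun hx1 => ?_)
  rw [and_comm, Complex.ofReal_add, Complex.ofReal_inv]
  refine and_congr_left ?_
  rintro rfl
  refine (hasEigenvalue_multipleStarRayOperator_iff (Complex.ofReal_ne_zero.2 hx)
    (by rwa [Complex.norm_real])).trans ?_
  rw [← Complex.ofReal_pow, starSum_ofReal, Complex.ofReal_eq_one]

theorem mem_spectrum_multipleStarRayOperator_diff_band_iff_starEquation {z : ℂ} :
    z ∈ spectrum ℂ (multipleStarRayOperator k) \ band ↔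
      ∃ t, 0 < t ∧ StarEquation k t ∧
        (z = ((2 * Real.cosh t : ℝ) : ℂ) ∨ z = ((-(2 * Real.cosh t) : ℝ) : ℂ)) := by
  have hcosh (t : ℝ) : Real.exp (-t) + (Real.exp (-t))⁻¹ = 2 * Real.cosh t := by
    rw [← Real.exp_neg, neg_neg, Real.cosh_eq]
    ring
  rw [mem_spectrum_multipleStarRayOperator_diff_band_iff]
  constructor
  · rintro ⟨x, hx, hx1, hstar, rfl⟩
    have ht : 0 < -Real.log |x| := neg_pos.2 (Real.log_neg (abs_pos.2 hx) hx1)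
    have habs : Real.exp (- -Real.log |x|) = |x| := by rw [neg_neg, Real.exp_log (abs_pos.2 hx)]
    refine ⟨-Real.log |x|, ht, ?_, ?_⟩
    · rwa [starEquation_iff_starSum_eq_one ht, habs, sq_abs]
    · rw [← hcosh, habs]
      rcases abs_choice x with h | h <;> rw [h]
      · exact Or.inl rfl
      · right
        rw [inv_neg, ← neg_add, neg_neg]
  · rintro ⟨t, ht, hstar, hz⟩
    have hexp := Real.exp_pos (-t)
    have hexp1 : Real.exp (-t) < 1 := Real.exp_lt_one_iff.2 (neg_lt_zero.2 ht)
    rw [starEquation_iff_starSum_eq_one ht] at hstar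
    rcases hz with rfl | rfl
    · exact ⟨Real.exp (-t), hexp.ne', by rwa [abs_of_pos hexp], hstar, by rw [hcosh]⟩
    · exact ⟨-Real.exp (-t), neg_ne_zero.2 hexp.ne', by rwa [abs_neg, abs_of_pos hexp],
        by rwa [neg_sq], by rw [inv_neg, ← neg_add, hcosh]⟩

end StarSpectrum

end TailedGraph
end

theorem mainTheorem2 (n : ℕ) (hn : 2 ≤ n) (k : Fin n → ℕ) (hk : ∀ j, 1 ≤ k j)
    (hne : ¬ (n = 2 ∧ ∀ j, k j = 1)) :
    (∃ tp : ℝ,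
      (0 < tp ∧ TailedGraph.StarEquation k tp ∧
        ∀ t : ℝ, 0 < t → TailedGraph.StarEquation k t → t = tp) ∧
      TailedGraph.discreteSpectrum (TailedGraph.multipleStarRayOperator k) =
        {((2 * Real.cosh tp : ℝ) : ℂ), ((-(2 * Real.cosh tp) : ℝ) : ℂ)} ∧
      spectrum ℂ (TailedGraph.multipleStarRayOperator k) \ TailedGraph.band =
        {((2 * Real.cosh tp : ℝ) : ℂ), ((-(2 * Real.cosh tp) : ℝ) : ℂ)}) ∧
    ∀ p : ℕ, (∀ j, k j = p) → ∀ t : ℝ, 0 < t →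
      (TailedGraph.StarEquation k t ↔
        ((n : ℝ) - 1) * Real.exp (-t) ^ (2 * p + 2) - (n : ℝ) * Real.exp (-t) ^ 2 + 1 = 0) := by
  refine ⟨?_, fun p hp t ht => TailedGraph.starEquation_iff_of_forall_eq hp ht⟩
  obtain ⟨tp, ⟨htp, hstar⟩, hunique⟩ :=
    TailedGraph.existsUnique_starEquation (TailedGraph.one_lt_starSum_one hn hk hne)
  have hdiscrete : TailedGraph.discreteSpectrum (TailedGraph.multipleStarRayOperator k)
      = spectrum ℂ (TailedGraph.multipleStarRayOperator k) \ TailedGraph.band :=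
    TailedGraph.discreteSpectrum_coupling_ray _
  have hspectrum : spectrum ℂ (TailedGraph.multipleStarRayOperator k) \ TailedGraph.band
      = {((2 * Real.cosh tp : ℝ) : ℂ), ((-(2 * Real.cosh tp) : ℝ) : ℂ)} := by
    ext z
    rw [TailedGraph.mem_spectrum_multipleStarRayOperator_diff_band_iff_starEquation]
    constructor
    · rintro ⟨t, ht, hst, hz⟩
      exact hunique t ⟨ht, hst⟩ ▸ hz
    · exact fun hz => ⟨tp, htp, hstar, hz⟩
  exact ⟨tp, ⟨htp, hstar, fun t ht hst => hunique t ⟨ht, hst⟩⟩, hdiscrete.trans hspectrum,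
    hspectrum⟩
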